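/- A mixed graph $X$ on a finite vertex set $V$ consists of undirected edges (digons) and directed edges (arcs), without loops and with at most one digon or arc joining any two vertices; its underlying graph is obtained by forgetting the orientations. For a complex number $\alpha$ with $|\alpha|=1$, the $\alpha$-hermitian adjacency matrix $H_\alpha=[h_{uv}]$ of $X$ has $h_{uv}=1$ if $uv$ is a digon, $h_{uv}=\alpha$ if there is an arc from $u$ to $v$, $h_{uv}=\overline{\alpha}$ if there is an arc from $v$ to $u$, and $h_{uv}=0$ otherwise. For a path $P=r_1r_2\cdots r_k$ of the underlying graph put $h_\alpha(P)=h_{r_1r_2}h_{r_2r_3}\cdots h_{r_{k-1}r_k}$, and let $|E(P)|$ be its number of edges. Suppose that the underlying graph of $X$ is bipartite and unicyclic (connected with exactly one cycle $C$) and has a unique perfect matching $\mathcal M$. A peg is an edge of $\mathcal M$ that is incident to a vertex of $C$ but is not an edge of $C$. A co-augmenting path is a path with at least one edge whose edges alternate between matching edges and non-matching edges and whose first and last edges are matching edges. Suppose that $X$ has more than two pegs. Then: 1. For every $\alpha\in\mathbb C$ with $|\alpha|=1$, the matrix $H_\alpha$ is invertible. For all vertices $i,j$ there is at most one co-augmenting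 path from $i$ to $j$, and $$(H_\alpha^{-1})_{ij}=\begin{cases}(-1)^{\frac{|E(P)|-1}{2}}\,h_\alpha(P)&\text{if } P \text{ is a co-augmenting path from } i \text{ to } j,\\ 0&\text{if there is no co-augmenting path from } i \text{ to } j.\end{cases}$$ 2. Let $\gamma=e^{2\pi i/3}$. Suppose in addition that $C$ has an even number of non-matching edges. For $u,v\in V$ let $w_u(v)=(-1)^m$, where $m$ is the number of non-matching edges on a path from $u$ to $v$; this does not depend on the choice of the path. Let $D_u$ be the diagonal matrix with diagonal entries $w_u(v)$, $v\in V$. Then for every vertex $u$ the matrix $D_uH_\gamma^{-1}D_u$ is the $\gamma$-hermitian adjacency matrix of a mixed graph on $V$. -/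

import Mathlib

/-- A mixed graph on the vertex set `V`: some edges are undirected (digons), the others carry
exactly one orientation (arcs). No loops and no multiple edges. -/
structure MixedGraph (V : Type*) where
  /-- the undirected edges -/
  digon : SimpleGraph V
  /-- `arc x y`: there is an arc with initial vertex `x` and terminal vertex `y` -/
  arc : V → V → Prop
  arc_asymm : ∀ x y, arc x y → ¬ arc y x
  arc_not_digon : ∀ x y, arc x y → ¬ digon.Adj x y

namespace MixedGraph

variable {V : Type*}

/-- The underlying graph, obtained by forgetting the orientations of the arcs. -/
def underlying (X : MixedGraph V) : SimpleGraph V where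
  Adj x y := X.digon.Adj x y ∨ X.arc x y ∨ X.arc y x
  symm := ⟨fun _ _ h => h.elim (fun h => Or.inl h.symm) (fun h => Or.inr h.symm)⟩
  loopless := ⟨fun x h => h.elim (fun h => h.ne rfl)
    (fun h => h.elim (fun h => X.arc_asymm x x h h) (fun h => X.arc_asymm x x h h))⟩

open Classical in
/-- The `α`-hermitian adjacency matrix of a mixed graph. -/
noncomputable def hermAdj (X : MixedGraph V) (α : ℂ) : Matrix V V ℂ :=
  Matrix.of fun u v =>
    if X.digon.Adj u v then 1
    else if X.arc u v then α
    else if X.arc v u then (starRingEnd ℂ) α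
    else 0

/-- The value `h_α(W)` of a walk `W = r₁ r₂ … r_k`: the product of the matrix entries
`h_{r₁ r₂} h_{r₂ r₃} ⋯` along the walk. -/
noncomputable def walkValue (X : MixedGraph V) (α : ℂ) {i j : V}
    (W : X.underlying.Walk i j) : ℂ :=
  (W.darts.map fun d => X.hermAdj α d.fst d.snd).prod

end MixedGraph

namespace UnicyclicMatching

variable {V : Type*} {G : SimpleGraph V}

/-- `M` is a perfect matching of `G`, and the only one. -/
def IsUniquePerfectMatching (M : G.Subgraph) : Prop :=
  M.IsPerfectMatching ∧ ∀ M' : G.Subgraph, M'.IsPerfectMatching → M' = M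

/-- `C` is a cycle of `G`, regarded as a subgraph. -/
def IsCycleSubgraph (C : G.Subgraph) : Prop :=
  ∃ (v : V) (c : G.Walk v v), c.IsCycle ∧ c.toSubgraph = C

/-- `G` is unicyclic: connected, with exactly one cycle. -/
def IsUnicyclic (G : SimpleGraph V) : Prop :=
  G.Connected ∧ ∃! C : G.Subgraph, IsCycleSubgraph C

/-- The pegs: the matching edges that are incident to a vertex of the cycle `C`
but are not themselves edges of `C`. -/
def pegs (M C : G.Subgraph) : Set (Sym2 V) :=
  {e | e ∈ M.edgeSet ∧ e ∉ C.edgeSet ∧ ∃ v ∈ C.verts, v ∈ e}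

/-- The edges of `C` that are not matching edges. -/
def unmatchedEdges (M C : G.Subgraph) : Set (Sym2 V) :=
  {e | e ∈ C.edgeSet ∧ e ∉ M.edgeSet}

/-- A co-augmenting path: a path whose edges are alternately in and not in the matching,
and which has a first and a last edge, both in the matching. -/
def IsCoaugmenting (M : G.Subgraph) {i j : V} (P : G.Walk i j) : Prop :=
  P.IsPath ∧
  P.edges.IsChain (fun e f => e ∈ M.edgeSet ↔ f ∉ M.edgeSet) ∧
  (∃ e ∈ P.edges.head?, e ∈ M.edgeSet) ∧
  (∃ e ∈ P.edges.getLast?, e ∈ M.edgeSet)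

open Classical in
/-- The sign at the last vertex of a walk `W`, when the first vertex gets the value `1`, the value
is kept along a matching edge and changes sign along a non-matching edge. -/
noncomputable def walkSign (M : G.Subgraph) {u v : V} (W : G.Walk u v) : ℂ :=
  (W.edges.map fun e => if e ∈ M.edgeSet then (1 : ℂ) else -1).prod

open Classical in
/-- The function `w`: `w v` is the sign at `v` of a (chosen) path from `u` to `v`;
the value `1` is used only when there is no path. -/
noncomputable def pathSign (M : G.Subgraph) (u v : V) : ℂ :=
  if h : ∃ W : G.Walk u v, W.IsPath then walkSign M h.choose else 1

open Classical in
/-- The diagonal matrix `D_u`. -/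
noncomputable def signMatrix (M : G.Subgraph) (u : V) : Matrix V V ℂ :=
  Matrix.diagonal (pathSign M u)

/-- The primitive third root of unity `γ = exp(2πi/3)`. -/
noncomputable def γ : ℂ := Complex.exp (2 * Real.pi * Complex.I / 3)

end UnicyclicMatching

/-! Let `N` be the matrix of signed values of co-augmenting paths; it is shown that `H * N = 1`. Let
`i'` be the partner of `i`. If `ik` is a non-matching edge and `P` is co-augmenting from `k` to `j`,
then `i' i P` is co-augmenting: were `i` on `P`, bipartiteness would give an alternating cycle,
contradicting uniqueness of the matching (`isCoaugmenting_cons_cons`). So row `i` times column `j`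
is governed by the single co-augmenting path from `i'` to `j`: it is the edge `i'i` when `i = j`,
and otherwise the terms of `i'` and of the next vertex `k` cancel.

At most one such path exists (`coaugmenting_unique`): two would enclose `C`, and only the two
branching vertices of `C` could carry pegs.

For `γ`, path values are cube roots of unity. When `C` has sign `1`, signs of walks depend only on
their ends, so conjugation by `D_u` removes the sign of every entry. -/

namespace UnicyclicMatching

open SimpleGraph

variable {V : Type*} {G : SimpleGraph V}

/-! ### Alternating walks -/

/-- Walks with edges alternately in and not in `M`, the first and the last one in `M`. -/
inductive IsAltWalk (M : G.Subgraph) : ∀ {i j : V}, G.Walk i j → Prop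
  | single {i j : V} (h : G.Adj i j) (hm : M.Adj i j) : IsAltWalk M (Walk.cons h Walk.nil)
  | step {i i' k j : V} (h : G.Adj i i') (hm : M.Adj i i') (h' : G.Adj i' k)
      (hn : ¬ M.Adj i' k) (p : G.Walk k j) (hp : IsAltWalk M p) :
      IsAltWalk M (Walk.cons h (Walk.cons h' p))

theorem isAltWalk_of_isChain (M : G.Subgraph) : ∀ {i j : V} (P : G.Walk i j),
    P.edges.IsChain (fun e f => e ∈ M.edgeSet ↔ f ∉ M.edgeSet) →
    (∃ e ∈ P.edges.head?, e ∈ M.edgeSet) → (∃ e ∈ P.edges.getLast?, e ∈ M.edgeSet) →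
    IsAltWalk M P
  | _, _, .nil, _, hh, _ => by simp at hh
  | _, _, .cons h .nil, _, hh, _ => .single h (by simpa using hh)
  | _, _, .cons h (.cons h' .nil), hc, hh, hl => by
      simp at hc hh hl
      exact absurd hl (hc.1 hh)
  | _, _, .cons h (.cons h' (.cons h'' p)), hc, hh, hl => by
      simp only [Walk.edges_cons, List.isChain_cons_cons, Subgraph.mem_edgeSet] at hc
      have hm := by simpa using hh
      have hn := hc.1.1 hm
      have hm' := not_not.1 (fun h => hn (hc.2.1.2 h))
      refine .step h hm h' hn _ (isAltWalk_of_isChain M (.cons h'' p) ?_ ?_ ?_)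
      · simpa using hc.2.2
      · simpa using hm'
      · simpa [List.getLast?_cons_cons] using hl

theorem IsAltWalk.exists_edges_eq_cons {M : G.Subgraph} {i j : V} {P : G.Walk i j}
    (hP : IsAltWalk M P) : ∃ e l, P.edges = e :: l ∧ e ∈ M.edgeSet := by
  cases hP with
  | single h hm => exact ⟨_, _, rfl, hm⟩
  | step h hm h' hn p hp => exact ⟨_, _, rfl, hm⟩

theorem IsAltWalk.isChain {M : G.Subgraph} {i j : V} {P : G.Walk i j} (hP : IsAltWalk M P) :
    P.edges.IsChain (fun e f => e ∈ M.edgeSet ↔ f ∉ M.edgeSet) ∧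
      ∃ e ∈ P.edges.getLast?, e ∈ M.edgeSet := by
  induction hP with
  | single h hm => simpa using hm
  | step h hm h' hn p hp ih =>
    obtain ⟨e, l, hel, he⟩ := hp.exists_edges_eq_cons
    rw [Walk.edges_cons, Walk.edges_cons, hel]
    rw [hel] at ih
    simp only [List.isChain_cons_cons, List.getLast?_cons_cons, Subgraph.mem_edgeSet]
    exact ⟨⟨by simp [hm, hn], by simp [he, hn], ih.1⟩, ih.2⟩

/-- The inductive form consumes two edges at a time, so parity is built into later inductions. -/
theorem isCoaugmenting_iff (M : G.Subgraph) {i j : V} (P : G.Walk i j) :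
    IsCoaugmenting M P ↔ P.IsPath ∧ IsAltWalk M P := by
  constructor
  · rintro ⟨h, hc, hh, hl⟩
    exact ⟨h, isAltWalk_of_isChain M P hc hh hl⟩
  · rintro ⟨h, ha⟩
    obtain ⟨e, l, hel, he⟩ := ha.exists_edges_eq_cons
    exact ⟨h, ha.isChain.1, ⟨e, by simp [hel], he⟩, ha.isChain.2⟩

theorem IsAltWalk.ne_of_isPath {M : G.Subgraph} {i j : V} {P : G.Walk i j}
    (hP : IsAltWalk M P) (hp : P.IsPath) : i ≠ j := by
  rintro rfl
  obtain ⟨e, l, hel, -⟩ := hP.exists_edges_eq_cons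
  rw [Walk.eq_nil_iff_nil.2 (Walk.isPath_iff_nil.1 hp)] at hel
  simp at hel

/-- A perfect matching's edges at the vertices of an alternating walk all lie on the walk. -/
theorem IsAltWalk.mem_edges {M : G.Subgraph} (hM : M.IsPerfectMatching) {i j : V}
    {P : G.Walk i j} (hP : IsAltWalk M P) {v w : V} (hv : v ∈ P.support) (hvw : M.Adj v w) :
    s(v, w) ∈ P.edges := by
  have huniq : ∀ {a b c : V}, M.Adj a b → M.Adj a c → b = c := fun h h' =>
    hM.1.eq_of_adj_left h h'
  induction hP with
  | single h hm =>
    simp only [Walk.support_cons, Walk.support_nil, List.mem_cons, List.not_mem_nil, or_false] at hv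
    rcases hv with rfl | rfl
    · simp [huniq hvw hm]
    · simp [huniq hvw hm.symm]
  | step h hm h' hn p hp ih =>
    simp only [Walk.support_cons, List.mem_cons] at hv
    rcases hv with rfl | rfl | hv
    · simp [huniq hvw hm]
    · simp [huniq hvw hm.symm]
    · simp [ih hv]

theorem IsAltWalk.odd_length {M : G.Subgraph} {i j : V} {P : G.Walk i j} (hP : IsAltWalk M P) :
    Odd P.length := by
  induction hP with
  | single h hm => simp
  | step h hm h' hn p hp ih =>
    simp only [Walk.length_cons]
    grind

/-! ### Signs of walks -/

theorem walkSign_nil (M : G.Subgraph) (u : V) : walkSign M (Walk.nil : G.Walk u u) = 1 := by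
  simp [walkSign]

open Classical in
theorem walkSign_cons (M : G.Subgraph) {u v w : V} (h : G.Adj u v) (p : G.Walk v w) :
    walkSign M (.cons h p) = (if M.Adj u v then 1 else -1) * walkSign M p := by
  simp [walkSign]

theorem walkSign_append (M : G.Subgraph) {u v w : V} (p : G.Walk u v) (q : G.Walk v w) :
    walkSign M (p.append q) = walkSign M p * walkSign M q := by
  simp [walkSign]

theorem walkSign_reverse (M : G.Subgraph) {u v : V} (p : G.Walk u v) :
    walkSign M p.reverse = walkSign M p := by
  simp [walkSign, List.prod_reverse]

theorem walkSign_mul_self (M : G.Subgraph) {u v : V} (p : G.Walk u v) :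
    walkSign M p * walkSign M p = 1 := by
  induction p with
  | nil => simp [walkSign_nil]
  | cons h p ih =>
    rw [walkSign_cons, mul_mul_mul_comm, ih]
    split_ifs <;> simp

theorem IsAltWalk.walkSign_eq {M : G.Subgraph} {i j : V} {P : G.Walk i j} (hP : IsAltWalk M P) :
    walkSign M P = (-1) ^ ((P.length - 1) / 2) := by
  induction hP with
  | single h hm => simp [walkSign_cons, walkSign_nil, hm]
  | step h hm h' hn p hp ih =>
    obtain ⟨m, hm'⟩ := hp.odd_length
    rw [walkSign_cons, walkSign_cons, ih, if_pos hm, if_neg hn, Walk.length_cons, Walk.length_cons,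
      hm', show (2 * m + 1 + 1 + 1 - 1) / 2 = m + 1 by omega,
      show (2 * m + 1 - 1) / 2 = m by omega]
    ring

open Classical in
theorem walkSign_eq_pow (M : G.Subgraph) {u v : V} (p : G.Walk u v) :
    walkSign M p = (-1) ^ (p.edges.filter (· ∉ M.edgeSet)).length := by
  unfold walkSign
  induction p.edges with
  | nil => simp
  | cons e l ih =>
    by_cases he : e ∈ M.edgeSet <;> simp [he, ih, pow_succ]

theorem walkSign_of_isTrail (M : G.Subgraph) {u v : V} (p : G.Walk u v) (hp : p.IsTrail) :
    walkSign M p = (-1) ^ (unmatchedEdges M p.toSubgraph).ncard := by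
  classical
  rw [walkSign_eq_pow, ← List.toFinset_card_of_nodup (hp.edges_nodup.filter _),
    ← Set.ncard_coe_finset]
  congr 2
  ext e
  simp [unmatchedEdges]

/-- If every cycle has sign `1`, then the sign of a path depends only on its ends. -/
theorem walkSign_eq_of_isPath {M : G.Subgraph}
    (hcyc : ∀ (a : V) (c : G.Walk a a), c.IsCycle → walkSign M c = 1) {u v : V}
    {p q : G.Walk u v} (hp : p.IsPath) (hq : q.IsPath) : walkSign M p = walkSign M q := by
  induction hs : p.length using Nat.strongRec generalizing u v with | ind s ih =>
  by_cases! hpq : p = q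
  · rw [hpq]
  -- Split at a common interior vertex; without one, the two paths together form a cycle.
  by_cases! hw : ∃ w, w ∈ p.support ∧ w ∈ q.support ∧ w ≠ u ∧ w ≠ v
  · classical
    have ⟨w, hwp, hwq, hwu, hwv⟩ := hw
    rw [← p.take_spec hwp, ← q.take_spec hwq, walkSign_append, walkSign_append,
      ih _ (hs ▸ p.length_takeUntil_lt_length hwp hwv) (hp.takeUntil hwp) (hq.takeUntil hwq) rfl,
      ih _ (hs ▸ p.length_dropUntil_lt_length hwp hwu) (hp.dropUntil hwp) (hq.dropUntil hwq) rfl]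
  · have hc : (p.append q.reverse).IsCycle := by
      refine hp.isCycle_append (Walk.isPath_reverse_iff q |>.mpr hq) (fun _ ↦ ?_) ?_
      · grind [Walk.dropLast_support_concat, Walk.IsPath.support_nodup, Walk.support_reverse,
          Walk.cons_tail_support]
      · grind [Walk.length_reverse, Walk.eq_of_length_le_one]
    have h1 := hcyc _ _ hc
    rw [walkSign_append, walkSign_reverse] at h1
    have h2 := walkSign_mul_self M q
    calc walkSign M p = walkSign M p * (walkSign M q * walkSign M q) := by rw [h2, mul_one]
      _ = walkSign M q := by rw [← mul_assoc, h1, one_mul]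

theorem walkSign_cycle {M C : G.Subgraph} (huni : IsUnicyclic G) (hC : IsCycleSubgraph C)
    (heven : Even (unmatchedEdges M C).ncard) (a : V) (c : G.Walk a a) (hc : c.IsCycle) :
    walkSign M c = 1 := by
  rw [walkSign_of_isTrail M c hc.1.1, huni.2.unique ⟨a, c, hc, rfl⟩ hC, heven.neg_one_pow]

theorem pathSign_eq {M : G.Subgraph}
    (hcyc : ∀ (a : V) (c : G.Walk a a), c.IsCycle → walkSign M c = 1) {u v : V}
    (W : G.Walk u v) (hW : W.IsPath) : pathSign M u v = walkSign M W := by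
  have h : ∃ W : G.Walk u v, W.IsPath := ⟨W, hW⟩
  rw [pathSign, dif_pos h]
  exact walkSign_eq_of_isPath hcyc h.choose_spec hW

/-- It suffices to cross one edge `xy`. If a path from `u` to `x` avoids `y`, extend it; otherwise
its piece from `y` to `x` has the same sign as the edge. -/
theorem pathSign_mul_walkSign {M : G.Subgraph} (hG : G.Connected)
    (hcyc : ∀ (a : V) (c : G.Walk a a), c.IsCycle → walkSign M c = 1) (u : V) {i j : V}
    (W : G.Walk i j) : pathSign M u i * walkSign M W = pathSign M u j := by
  classical
  induction W with
  | nil => simp [walkSign_nil]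
  | @cons x y z h p ih =>
    rw [walkSign_cons, ← ih, ← mul_assoc]
    congr 1
    obtain ⟨P, hP⟩ := (hG.preconnected u x).exists_isPath
    rw [pathSign_eq hcyc P hP]
    by_cases hy : y ∈ P.support
    · rw [pathSign_eq hcyc _ (hP.takeUntil hy)]
      have h1 : walkSign M (P.dropUntil y hy) = walkSign M (Walk.cons h.symm Walk.nil) :=
        walkSign_eq_of_isPath hcyc (hP.dropUntil hy) (by simp [h.ne'])
      conv_lhs => rw [← P.take_spec hy]
      rw [walkSign_append, h1, walkSign_cons, walkSign_nil, M.adj_comm y x]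
      split_ifs <;> simp
    · rw [pathSign_eq hcyc _ (hP.concat hy h), Walk.concat_eq_append, walkSign_append,
        walkSign_cons, walkSign_nil, mul_one]

/-! ### Uniqueness of co-augmenting paths -/

/-- If there are more than two pegs, a co-augmenting path is determined by its ends. -/
theorem coaugmenting_unique {M C : G.Subgraph} (huni : IsUnicyclic G)
    (hM : M.IsPerfectMatching) (hC : IsCycleSubgraph C) (hpegs : 2 < (pegs M C).ncard)
    {i j : V} {P Q : G.Walk i j} (hP : IsCoaugmenting M P) (hQ : IsCoaugmenting M Q) :
    P = Q := by
  rw [isCoaugmenting_iff] at hP hQ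
  by_contra hne
  obtain ⟨a, b, p, q, hp, hq, hc⟩ := hP.1.exists_isCycle_of_ne hQ.1 hne
  have hCe : (p.append q.reverse).toSubgraph = C := huni.2.unique ⟨_, _, hc, rfl⟩ hC
  obtain ⟨a', ha'⟩ := (Subgraph.isPerfectMatching_iff.1 hM a).exists
  obtain ⟨b', hb'⟩ := (Subgraph.isPerfectMatching_iff.1 hM b).exists
  -- The matching edge at `v` lies on `P`; since `P` visits `v` only once, that edge lies in the
  -- piece `p` to which `v` is interior.
  have key : ∀ {P : G.Walk i j} {p : G.Walk a b}, P.IsPath → IsAltWalk M P → p.IsSubwalk P →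
      ∀ v w, v ∈ p.support → M.Adj v w → v ≠ a → v ≠ b → s(v, w) ∈ p.edges := by
    rintro P p hP hA ⟨r, t, rfl⟩ v w hv hvw hva hvb
    have he := hA.mem_edges hM (v := v) (w := w) (by simp [hv]) hvw
    rw [Walk.edges_append, Walk.edges_append, List.mem_append, List.mem_append] at he
    rcases he with (he | he) | he
    · exact absurd rfl (hP.of_append_left.ne_of_mem_support_of_append hva
        (r.fst_mem_support_of_mem_edges he) hv)
    · exact he
    · exact absurd rfl (hP.ne_of_mem_support_of_append hvb
        (x := v) (by simp [hv]) (t.fst_mem_support_of_mem_edges he))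
  have hsub : pegs M C ⊆ {s(a, a'), s(b, b')} := by
    rintro e ⟨heM, heC, v, hvC, hve⟩
    obtain ⟨w, rfl⟩ := hve
    rw [Subgraph.mem_edgeSet] at heM
    rw [← hCe, Walk.mem_edges_toSubgraph] at heC
    rw [← hCe, Walk.mem_verts_toSubgraph] at hvC
    simp only [Walk.edges_append, Walk.edges_reverse, List.mem_append, List.mem_reverse,
      not_or] at heC
    by_cases hva : v = a
    · subst hva; left; rw [hM.1.eq_of_adj_left heM ha']
    by_cases hvb : v = b
    · subst hvb; right; rw [hM.1.eq_of_adj_left heM hb']; rfl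
    rw [Walk.mem_support_append_iff, Walk.support_reverse, List.mem_reverse] at hvC
    rcases hvC with hv | hv
    · exact absurd (key hP.1 hP.2 hp v w hv heM hva hvb) heC.1
    · exact absurd (key hQ.1 hQ.2 hq v w hv heM hva hvb) heC.2
  have := (Set.ncard_le_ncard hsub (by simp)).trans (Set.ncard_insert_le _ _)
  rw [Set.ncard_singleton] at this
  omega

/-! ### Alternating cycles and extension of paths -/

/-- A uniquely matched graph has no alternating cycle. -/
theorem not_adj_of_coaugmenting {M : G.Subgraph} (hM : IsUniquePerfectMatching M) {i k : V}
    (hik : G.Adj i k) (hn : ¬ M.Adj i k) {P : G.Walk k i} (hP : P.IsPath)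
    (hA : IsAltWalk M P) : False := by
  -- The only edge of `P` at its start `k` is its first one, which is matching.
  have hnot : s(i, k) ∉ P.edges := by
    intro h
    cases hA with
    | single h' hm => exact hn hm.symm
    | step h' hm h'' hn' p hp =>
      rw [Walk.edges_cons, List.mem_cons] at h
      rw [Walk.cons_isPath_iff] at hP
      rcases h with h | h
      · rcases Sym2.eq_iff.1 h with ⟨h1, -⟩ | ⟨h1, -⟩
        · exact hik.ne h1
        · subst h1
          exact hn hm.symm
      · exact hP.2 (Walk.snd_mem_support_of_mem_edges _ h)
  have hc : (Walk.cons hik P).IsCycle := (Walk.cons_isCycle_iff P hik).2 ⟨hP, hnot⟩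
  set c := Walk.cons hik P with hcdef
  have hcyc := hc.isCycles_spanningCoe_toSubgraph
  have halt : c.toSubgraph.spanningCoe.IsAlternating M.spanningCoe := by
    intro v w w' hne hw hw'
    simp only [Subgraph.spanningCoe_adj]
    constructor
    · intro h h'
      exact hne (hM.1.1.eq_of_adj_left h h')
    · intro h
      -- Every vertex of the cycle is on `P`, so its matching edge is one of its two cycle edges.
      have hv : v ∈ P.support := by
        have := Walk.mem_support_of_adj_toSubgraph (p := c) hw
        rw [hcdef, Walk.support_cons, List.mem_cons] at this
        rcases this with rfl | h
        · exact P.end_mem_support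
        · exact h
      obtain ⟨x, hx⟩ := (Subgraph.isPerfectMatching_iff.1 hM.1 v).exists
      have hxc : c.toSubgraph.Adj v x := by
        rw [Walk.adj_toSubgraph_iff_mem_edges, hcdef, Walk.edges_cons]
        exact List.mem_cons_of_mem _ (hA.mem_edges hM.1 hv hx)
      have h2 := hcyc (v := v) ⟨w, hw⟩
      obtain ⟨y, z, -, hyz⟩ := Set.ncard_eq_two.1 h2
      have h3 : w ∈ ({y, z} : Set V) := hyz ▸ hw
      have h4 : w' ∈ ({y, z} : Set V) := hyz ▸ hw'
      have h5 : x ∈ ({y, z} : Set V) := hyz ▸ hxc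
      have : x = w ∨ x = w' := by
        simp only [Set.mem_insert_iff, Set.mem_singleton_iff] at h3 h4 h5
        grind
      rcases this with rfl | rfl
      · exact hx
      · exact absurd hx h
  -- Switching along the cycle gives a second perfect matching, containing `ik`.
  have hpm := hM.1.symmDiff_of_isAlternating halt hcyc
  have hle : (⊤ : Subgraph (symmDiff M.spanningCoe c.toSubgraph.spanningCoe)).spanningCoe ≤ G := by
    intro x y hxy
    replace hxy : (M.spanningCoe \ c.toSubgraph.spanningCoe ⊔
      c.toSubgraph.spanningCoe \ M.spanningCoe).Adj x y := hxy
    rcases hxy with h | h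
    · exact M.adj_sub h.1
    · exact c.toSubgraph.adj_sub h.1
  have hEq := hM.2 _ ((Subgraph.IsPerfectMatching.toSubgraph_iff hle).2 hpm)
  apply hn
  rw [← hEq]
  refine Or.inr ⟨?_, hn⟩
  rw [Subgraph.spanningCoe_adj, Walk.adj_toSubgraph_iff_mem_edges, hcdef, Walk.edges_cons]
  exact List.mem_cons_self

/-- Vertices at even distance along `P` share the colour of `k`; at odd distance the initial segment
ends with a matching edge. -/
theorem IsAltWalk.exists_initial {M : G.Subgraph} (col : G.Coloring (Fin 2)) {k j : V}
    {P : G.Walk k j} (hA : IsAltWalk M P) (hP : P.IsPath) {v : V} (hv : v ∈ P.support) :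
    col v = col k ∨ ∃ Q : G.Walk k v, IsAltWalk M Q ∧ Q.IsPath ∧ Q.support ⊆ P.support := by
  induction hA with
  | single h hm =>
    simp only [Walk.support_cons, Walk.support_nil, List.mem_cons, List.not_mem_nil, or_false] at hv
    rcases hv with rfl | rfl
    · exact .inl rfl
    · exact .inr ⟨_, .single h hm, hP, fun _ => id⟩
  | @step i i' l j h hm h' hn p hp ih =>
    simp only [Walk.support_cons, List.mem_cons] at hv
    rcases hv with rfl | rfl | hv
    · exact .inl rfl
    · exact .inr ⟨_, .single h hm, by simp [h.ne], by simp⟩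
    · rw [Walk.cons_isPath_iff, Walk.cons_isPath_iff] at hP
      rcases ih hP.1.1 hv with h1 | ⟨Q, hQ, hQp, hQs⟩
      · left
        have h2 := col.valid h
        have h3 := col.valid h'
        omega
      · refine .inr ⟨_, .step h hm h' hn Q hQ, ?_, ?_⟩
        · rw [Walk.cons_isPath_iff, Walk.cons_isPath_iff]
          refine ⟨⟨hQp, fun h => hP.1.2 (hQs h)⟩, fun h => hP.2 ?_⟩
          rw [Walk.support_cons, List.mem_cons] at h ⊢
          exact h.imp_right (fun h => hQs h)
        · simp only [Walk.support_cons]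
          exact List.cons_subset_cons _ (List.cons_subset_cons _ hQs)

/-- Prepending a non-matching edge and a matching edge to a co-augmenting path gives
a co-augmenting path. -/
theorem isCoaugmenting_cons_cons {M : G.Subgraph} (hbip : G.IsBipartite)
    (hM : IsUniquePerfectMatching M) {i i' k j : V} (hm : M.Adj i' i) (hik : G.Adj i k)
    (hn : ¬ M.Adj i k) {P : G.Walk k j} (hP : IsCoaugmenting M P) :
    IsCoaugmenting M (Walk.cons hm.adj_sub (Walk.cons hik P)) := by
  rw [isCoaugmenting_iff] at hP ⊢
  obtain ⟨col⟩ := hbip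
  have hi : i ∉ P.support := by
    intro hi
    rcases hP.2.exists_initial col hP.1 hi with h | ⟨Q, hQ, hQp, -⟩
    · exact col.valid hik h
    · exact not_adj_of_coaugmenting hM hik hn hQp hQ
  -- The matching edge at `i'` would bring `i` onto `P`.
  have hi' : i' ∉ P.support := fun h =>
    hi (P.snd_mem_support_of_mem_edges (hP.2.mem_edges hM.1 h hm))
  refine ⟨?_, .step _ hm _ hn P hP.2⟩
  rw [Walk.cons_isPath_iff, Walk.cons_isPath_iff, Walk.support_cons, List.mem_cons, not_or]
  exact ⟨⟨hP.1, hi⟩, hm.adj_sub.ne, hi'⟩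

end UnicyclicMatching

/-! ### Entries of the hermitian adjacency matrix -/

namespace MixedGraph

variable {V : Type*} (X : MixedGraph V)

theorem star_hermAdj (α : ℂ) (u v : V) :
    (starRingEnd ℂ) (X.hermAdj α u v) = X.hermAdj α v u := by
  have h1 := X.arc_asymm u v
  have h2 := X.digon.adj_comm u v
  simp only [hermAdj, Matrix.of_apply, h2]
  split_ifs <;> simp_all

theorem isHermitian_hermAdj (α : ℂ) : (X.hermAdj α).IsHermitian := by
  ext u v
  exact X.star_hermAdj α v u

theorem hermAdj_eq_zero (α : ℂ) {u v : V} (h : ¬ X.underlying.Adj u v) :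
    X.hermAdj α u v = 0 := by
  have h' : ¬ (X.digon.Adj u v ∨ X.arc u v ∨ X.arc v u) := h
  simp only [not_or] at h'
  simp [hermAdj, h'.1, h'.2.1, h'.2.2]

theorem hermAdj_of_adj (α : ℂ) {u v : V} (h : X.underlying.Adj u v) :
    X.hermAdj α u v = 1 ∨ X.hermAdj α u v = α ∨ X.hermAdj α u v = (starRingEnd ℂ) α := by
  have h' : X.digon.Adj u v ∨ X.arc u v ∨ X.arc v u := h
  simp only [hermAdj, Matrix.of_apply]
  split_ifs <;> simp_all

theorem hermAdj_mul_hermAdj {α : ℂ} (hα : ‖α‖ = 1) {u v : V} (h : X.underlying.Adj u v) :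
    X.hermAdj α u v * X.hermAdj α v u = 1 := by
  have hα' : (starRingEnd ℂ) α * α = 1 := by
    rw [mul_comm, Complex.mul_conj, Complex.normSq_eq_norm_sq, hα]
    simp
  rw [← X.star_hermAdj α u v]
  rcases X.hermAdj_of_adj α h with h | h | h <;> simp [h, hα', mul_comm α]

theorem walkValue_nil (α : ℂ) (u : V) :
    X.walkValue α (SimpleGraph.Walk.nil : X.underlying.Walk u u) = 1 := by
  simp [walkValue]

theorem walkValue_cons (α : ℂ) {u v w : V} (h : X.underlying.Adj u v)
    (p : X.underlying.Walk v w) :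
    X.walkValue α (.cons h p) = X.hermAdj α u v * X.walkValue α p := by
  simp [walkValue]

end MixedGraph

namespace UnicyclicMatching

open SimpleGraph

/-! ### The inverse matrix -/

section Inverse

variable {V : Type*} (X : MixedGraph V) (M : X.underlying.Subgraph)

open Classical in
/-- The matrix whose entries are the signed values of the co-augmenting paths. -/
noncomputable def pathMatrix (α : ℂ) : Matrix V V ℂ :=
  Matrix.of fun i j =>
    if h : ∃ P : X.underlying.Walk i j, IsCoaugmenting M P then
      (-1) ^ ((h.choose.length - 1) / 2) * X.walkValue α h.choose
    else 0

variable {X M}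

theorem pathMatrix_eq_zero (α : ℂ) {i j : V}
    (h : ¬ ∃ P : X.underlying.Walk i j, IsCoaugmenting M P) : pathMatrix X M α i j = 0 := by
  simp only [pathMatrix, Matrix.of_apply, dif_neg h]

theorem pathMatrix_eq
    (huniq : ∀ {i j : V} {P Q : X.underlying.Walk i j},
      IsCoaugmenting M P → IsCoaugmenting M Q → P = Q)
    (α : ℂ) {i j : V} {P : X.underlying.Walk i j} (hP : IsCoaugmenting M P) :
    pathMatrix X M α i j = walkSign M P * X.walkValue α P := by
  have h : ∃ P : X.underlying.Walk i j, IsCoaugmenting M P := ⟨P, hP⟩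
  rw [((isCoaugmenting_iff M P).1 hP).2.walkSign_eq]
  simp only [pathMatrix, Matrix.of_apply, dif_pos h]
  rw [huniq h.choose_spec hP]

theorem hermAdj_mul_pathMatrix [Fintype V] [DecidableEq V]
    (hbip : X.underlying.IsBipartite) (hM : IsUniquePerfectMatching M)
    (huniq : ∀ {i j : V} {P Q : X.underlying.Walk i j},
      IsCoaugmenting M P → IsCoaugmenting M Q → P = Q)
    {α : ℂ} (hα : ‖α‖ = 1) : X.hermAdj α * pathMatrix X M α = 1 := by
  ext i j
  obtain ⟨i', hm⟩ := (Subgraph.isPerfectMatching_iff.1 hM.1 i).exists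
  have hadj : X.underlying.Adj i i' := hm.adj_sub
  have hother : ∀ k, k ≠ i' → ¬ M.Adj i k := fun k hk h => hk (hM.1.1.eq_of_adj_left h hm)
  -- a term other than that of the partner comes from an extension of a co-augmenting path
  have hext : ∀ k, k ≠ i' → X.hermAdj α i k * pathMatrix X M α k j ≠ 0 →
      ∃ (h : X.underlying.Adj i k) (P : X.underlying.Walk k j), IsCoaugmenting M P ∧
        IsCoaugmenting M (Walk.cons hadj.symm (Walk.cons h P)) := by
    intro k hk h0
    have h : X.underlying.Adj i k := by
      by_contra h
      exact h0 (by rw [X.hermAdj_eq_zero α h, zero_mul])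
    have hP : ∃ P : X.underlying.Walk k j, IsCoaugmenting M P := by
      by_contra h
      exact h0 (by rw [pathMatrix_eq_zero α h, mul_zero])
    obtain ⟨P, hP⟩ := hP
    exact ⟨h, P, hP, isCoaugmenting_cons_cons hbip hM hm.symm h (hother k hk) hP⟩
  rw [Matrix.mul_apply]
  by_cases hQ : ∃ Q : X.underlying.Walk i' j, IsCoaugmenting M Q
  · obtain ⟨Q, hQ⟩ := hQ
    have hQ' := (isCoaugmenting_iff M Q).1 hQ
    obtain ⟨hQp, hQa⟩ := hQ'
    cases hQa with
    | @single _ _ h hmQ =>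
      obtain rfl : j = i := hM.1.1.eq_of_adj_left hmQ hm.symm
      rw [Finset.sum_eq_single i']
      · rw [pathMatrix_eq huniq α hQ, walkSign_cons, if_pos hmQ, walkSign_nil, X.walkValue_cons,
          X.walkValue_nil, Matrix.one_apply_eq, mul_one, mul_one, one_mul,
          X.hermAdj_mul_hermAdj hα hadj]
      -- Another nonzero term would give a second co-augmenting path from `i'` to `i`, longer than
      -- the edge.
      · intro k _ hk
        by_contra h0
        obtain ⟨h', P, hP, hP'⟩ := hext k hk h0
        have := congrArg Walk.length (huniq hP' hQ)
        simp at this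
      · simp
    | @step _ l k _ h hmQ h' hn p hp =>
      obtain rfl : l = i := hM.1.1.eq_of_adj_left hmQ hm.symm
      have hk : k ≠ i' := by rintro rfl; exact hn hm
      have hij : l ≠ j := by
        rintro rfl
        rw [Walk.cons_isPath_iff] at hQp
        have := Walk.eq_nil_iff_nil.2 (Walk.isPath_iff_nil.1 hQp.1)
        cases this
      have hpc : IsCoaugmenting M p :=
        (isCoaugmenting_iff M p).2 ⟨((Walk.cons_isPath_iff _ _).1
          ((Walk.cons_isPath_iff _ _).1 hQp).1).1, hp⟩
      -- Here `Q` is `i' l k p`. Its extra non-matching edge makes the two terms opposite, and a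
      -- third nonzero term would give another path beside `Q`.
      rw [Finset.sum_eq_add i' k hk.symm]
      · rw [pathMatrix_eq huniq α hQ, pathMatrix_eq huniq α hpc, walkSign_cons, walkSign_cons,
          if_pos hmQ, if_neg hn, X.walkValue_cons, X.walkValue_cons, Matrix.one_apply_ne hij]
        linear_combination (-walkSign M p * X.hermAdj α l k * X.walkValue α p) *
          X.hermAdj_mul_hermAdj hα hadj
      · rintro r _ ⟨hr, hrk⟩
        by_contra h0
        obtain ⟨h'', P, hP, hP'⟩ := hext r hr h0
        have := congrArg Walk.support (huniq hP' hQ)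
        simp only [Walk.support_cons, List.cons.injEq, true_and] at this
        rw [← P.cons_tail_support, ← p.cons_tail_support] at this
        exact hrk (List.cons.inj this).1
      · simp
      · simp
  · have hij : i ≠ j := by
      rintro rfl
      exact hQ ⟨Walk.cons hadj.symm Walk.nil, (isCoaugmenting_iff M _).2
        ⟨by simp [hadj.ne'], .single _ hm.symm⟩⟩
    rw [Matrix.one_apply_ne hij]
    refine Finset.sum_eq_zero fun k _ => ?_
    by_cases hk : k = i'
    · rw [hk, pathMatrix_eq_zero α hQ, mul_zero]
    · by_contra h0
      obtain ⟨h', P, hP, hP'⟩ := hext k hk h0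
      exact hQ ⟨_, hP'⟩

end Inverse

/-! ### Cube roots of unity -/

theorem signMatrix_eq_diagonal {V : Type*} [DecidableEq V] {G : SimpleGraph V} (M : G.Subgraph)
    (u : V) : signMatrix M u = Matrix.diagonal (pathSign M u) := by
  ext i j
  by_cases h : i = j <;> simp [signMatrix, h]

theorem γ_pow_three : γ ^ 3 = 1 := by
  rw [γ, ← Complex.exp_nat_mul, ← Complex.exp_two_pi_mul_I]
  congr 1
  push_cast
  ring

theorem norm_γ : ‖γ‖ = 1 := by
  have : γ = Complex.exp ((2 * Real.pi / 3 : ℝ) * Complex.I) := by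
    rw [γ]
    congr 1
    push_cast
    ring
  rw [this, Complex.norm_exp_ofReal_mul_I]

theorem conj_γ : (starRingEnd ℂ) γ = γ ^ 2 := by
  have h1 : (starRingEnd ℂ) γ * γ = 1 := by
    rw [mul_comm, Complex.mul_conj, Complex.normSq_eq_norm_sq, norm_γ]
    simp
  have h2 := γ_pow_three
  calc (starRingEnd ℂ) γ = (starRingEnd ℂ) γ * γ ^ 3 := by rw [h2, mul_one]
    _ = ((starRingEnd ℂ) γ * γ) * γ ^ 2 := by ring
    _ = γ ^ 2 := by rw [h1, one_mul]

theorem γ_ne_one : γ ≠ 1 := by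
  have h := Complex.isPrimitiveRoot_exp 3 (by norm_num)
  have h' : γ = Complex.exp (2 * Real.pi * Complex.I / (3 : ℕ)) := by
    rw [γ]; norm_num
  rw [h']
  exact h.ne_one (by norm_num)

theorem conj_γ_ne : (starRingEnd ℂ) γ ≠ γ := by
  rw [conj_γ]
  intro h
  apply γ_ne_one
  have h3 := γ_pow_three
  calc γ = γ ^ 2 := h.symm
    _ = γ * γ := sq γ
    _ = γ ^ 2 * γ := by rw [h]
    _ = γ ^ 3 := by ring
    _ = 1 := h3

/-- The cube roots of unity are closed under products, so walk values are again admissible matrix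
entries. -/
theorem walkValue_γ {V : Type*} (X : MixedGraph V) {u v : V} (W : X.underlying.Walk u v) :
    X.walkValue γ W = 1 ∨ X.walkValue γ W = γ ∨ X.walkValue γ W = (starRingEnd ℂ) γ := by
  have h3 := γ_pow_three
  have h4 : γ ^ 4 = γ := by rw [pow_succ, h3, one_mul]
  have key : ∀ a b : ℂ, (a = 1 ∨ a = γ ∨ a = γ ^ 2) → (b = 1 ∨ b = γ ∨ b = γ ^ 2) →
      (a * b = 1 ∨ a * b = γ ∨ a * b = γ ^ 2) := by
    rintro a b (rfl | rfl | rfl) (rfl | rfl | rfl) <;> ring_nf <;> simp [h3, h4]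
  rw [conj_γ]
  induction W with
  | nil => simp [X.walkValue_nil]
  | cons h p ih =>
    rw [X.walkValue_cons]
    refine key _ _ ?_ ih
    rw [← conj_γ]
    exact X.hermAdj_of_adj γ h

/-- A hermitian matrix with zero diagonal and entries `0`, `1`, `γ`, `γ̄` is the `γ`-hermitian
adjacency matrix of a mixed graph. -/
theorem exists_hermAdj_eq {V : Type*} (N : Matrix V V ℂ) (hN : N.IsHermitian)
    (h0 : ∀ v, N v v = 0)
    (hval : ∀ u v, N u v = 0 ∨ N u v = 1 ∨ N u v = γ ∨ N u v = (starRingEnd ℂ) γ) :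
    ∃ Y : MixedGraph V, N = Y.hermAdj γ := by
  have hconj : ∀ u v, N v u = (starRingEnd ℂ) (N u v) := fun u v => (hN.apply v u).symm
  have hne1 := γ_ne_one
  have hne := conj_γ_ne
  have hne0 : γ ≠ 0 := by
    intro h
    simpa [h] using norm_γ
  have hc1 : (starRingEnd ℂ) γ ≠ 1 := fun h => hne1 (by simpa using congrArg (starRingEnd ℂ) h)
  refine ⟨{ digon := { Adj := fun u v => N u v = 1
                       symm := ⟨fun u v h => by rw [hconj u v, h, map_one]⟩
                       loopless := ⟨fun v h => by simp [h0] at h⟩ }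
            arc := fun u v => N u v = γ
            arc_asymm := fun u v h h' => hne (by rw [← h, ← hconj u v, h', h])
            arc_not_digon := fun u v h h' => hne1 (h.symm.trans h') }, ?_⟩
  ext u v
  simp only [MixedGraph.hermAdj, Matrix.of_apply]
  have hvu := hconj u v
  rcases hval u v with h | h | h | h <;> rw [h] at hvu <;>
    simp [h, hvu, hne1, hne, hne0.symm, hc1]

end UnicyclicMatching

/-! ### The main theorem -/

open UnicyclicMatching in
theorem corollaryp1 {V : Type*} [Fintype V] [DecidableEq V] (X : MixedGraph V)
    (hbip : X.underlying.IsBipartite) (huni : IsUnicyclic X.underlying)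
    (M : X.underlying.Subgraph) (hM : IsUniquePerfectMatching M)
    (C : X.underlying.Subgraph) (hC : IsCycleSubgraph C)
    (hpegs : 2 < (pegs M C).ncard) :
    (∀ α : ℂ, ‖α‖ = 1 →
      IsUnit (X.hermAdj α) ∧
      ∀ i j : V,
        (∀ P Q : X.underlying.Walk i j, IsCoaugmenting M P → IsCoaugmenting M Q → P = Q) ∧
        (∀ P : X.underlying.Walk i j, IsCoaugmenting M P →
          (X.hermAdj α)⁻¹ i j = (-1) ^ ((P.length - 1) / 2) * X.walkValue α P) ∧
        ((¬ ∃ P : X.underlying.Walk i j, IsCoaugmenting M P) → (X.hermAdj α)⁻¹ i j = 0)) ∧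
    (Even (unmatchedEdges M C).ncard →
      ∀ u : V,
        (∀ (v : V) (W : X.underlying.Walk u v), W.IsPath → pathSign M u v = walkSign M W) ∧
        ∃ Y : MixedGraph V,
          signMatrix M u * (X.hermAdj γ)⁻¹ * signMatrix M u = Y.hermAdj γ) := by
  have huniq : ∀ {i j : V} {P Q : X.underlying.Walk i j},
      IsCoaugmenting M P → IsCoaugmenting M Q → P = Q :=
    fun hP hQ => coaugmenting_unique huni hM.1 hC hpegs hP hQ
  have hmul : ∀ {α : ℂ}, ‖α‖ = 1 → X.hermAdj α * pathMatrix X M α = 1 :=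
    fun hα => hermAdj_mul_pathMatrix hbip hM huniq hα
  refine ⟨fun α hα => ?_, fun heven u => ?_⟩
  · rw [Matrix.inv_eq_right_inv (hmul hα)]
    refine ⟨IsUnit.of_mul_eq_one _ (hmul hα), fun i j => ⟨fun _ _ hP hQ => huniq hP hQ,
      fun P hP => ?_, pathMatrix_eq_zero α⟩⟩
    rw [pathMatrix_eq huniq α hP, ((isCoaugmenting_iff M P).1 hP).2.walkSign_eq]
  · have hcyc := walkSign_cycle huni hC heven
    refine ⟨fun v W hW => pathSign_eq hcyc W hW, ?_⟩
    have hreal : ∀ v, star (pathSign M u v) = pathSign M u v := by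
      intro v
      obtain ⟨W, hW⟩ := (huni.1.preconnected u v).exists_isPath
      rw [pathSign_eq hcyc W hW, walkSign_eq_pow]
      simp
    have hsq : ∀ v, pathSign M u v * pathSign M u v = 1 := by
      intro v
      obtain ⟨W, hW⟩ := (huni.1.preconnected u v).exists_isPath
      rw [pathSign_eq hcyc W hW, walkSign_mul_self]
    have hD : (signMatrix M u).conjTranspose = signMatrix M u := by
      rw [signMatrix_eq_diagonal, Matrix.diagonal_conjTranspose]
      congr 1
      exact funext hreal
    have happ : ∀ i j, (signMatrix M u * (X.hermAdj γ)⁻¹ * signMatrix M u) i j =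
        pathSign M u i * pathMatrix X M γ i j * pathSign M u j := by
      intro i j
      rw [Matrix.inv_eq_right_inv (hmul norm_γ), signMatrix_eq_diagonal, Matrix.mul_diagonal,
        Matrix.diagonal_mul]
    apply exists_hermAdj_eq
    · have := Matrix.isHermitian_mul_mul_conjTranspose (signMatrix M u)
        (X.isHermitian_hermAdj γ).inv
      rwa [hD] at this
    · intro v
      rw [happ, pathMatrix_eq_zero, mul_zero, zero_mul]
      rintro ⟨P, hP⟩
      rw [isCoaugmenting_iff] at hP
      exact hP.2.ne_of_isPath hP.1 rfl
    · intro i j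
      rw [happ]
      by_cases h : ∃ P : X.underlying.Walk i j, IsCoaugmenting M P
      · obtain ⟨P, hP⟩ := h
        -- The sign of `P` turns `w_u(i)` into `w_u(j)`, and `w_u(j)` squares to `1`.
        have : pathSign M u i * pathMatrix X M γ i j * pathSign M u j = X.walkValue γ P := by
          rw [pathMatrix_eq huniq γ hP, ← mul_assoc,
            pathSign_mul_walkSign huni.1 hcyc, mul_right_comm, hsq, one_mul]
        rw [this]
        exact .inr (walkValue_γ X P)
      · left
        rw [pathMatrix_eq_zero γ h, mul_zero, zero_mul]
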